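/- Let $\Gamma$ be a discrete abelian group, written additively, with (compact) dual group $G$; each $\gamma\in\Gamma$ is regarded as a character $x\mapsto\gamma(x)$ of $G$. For a regular complex Borel measure $\mu$ on $G$, let $\|\mu\|$ be its total variation and $\hat\mu(\gamma)=\int_G\overline{\gamma(x)}\,d\mu(x)$ for $\gamma\in\Gamma$. For a finite or infinite sequence $(\gamma_j)$ in $\Gamma$, let $\mathrm{Schur}((\gamma_j))$ be the set of all $m\in\Gamma$ that can be written as $m=\sum_j\varepsilon_j\gamma_j$ with integers $\varepsilon_j$, only finitely many of them nonzero, such that - the full sum $\sum_j\varepsilon_j$ is equal to $1$; - all partial sums $\sum_{i\le j}\varepsilon_i$ are nonnegative; - all partial sums after the first positive one are positive; - some partial sum is greater than $1$. Let $S((\gamma_j))\subset\mathrm{Schur}((\gamma_j))$ be the set of those $m$ that have such a representation with all $\varepsilon_j\in\{-1,0,1\}$. **Theorem.** Let $K\subset\Gamma$, let $(\gamma_j)$ be an enumeration of $K$ as a finite or infinite sequence, and let $\mu$ be a regular complex Borel measure on $G$. If $\hat\mu$ vanishes on $\mathrm{Schur}((\gamma_j))$, then $$\|\hat\mu|_K\|_2=\Bigl(\sum_{\gamma\in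 K}|\hat\mu(\gamma)|^2\Bigr)^{1/2}\le 4\|\mu\|.$$ The same inequality holds under the weaker hypothesis that $\hat\mu$ vanishes on $S((\gamma_j))$. -/

import Mathlib

open MeasureTheory

/-- The dual group `G` of the abelian group `Γ` (written additively): the continuous homomorphisms
from `Γ` to the unit circle, with the compact-open topology. -/
abbrev DualGroup (Γ : Type*) [AddCommGroup Γ] [TopologicalSpace Γ] : Type _ :=
  PontryaginDual (Multiplicative Γ)

/-- The value `γ(x)` of the element `γ` of `Γ`, viewed as a character of the dual group,
at the point `x` of the dual group. -/
noncomputable def charValue {Γ : Type*} [AddCommGroup Γ] [TopologicalSpace Γ] (γ : Γ) (x : DualGroup Γ) : ℂ :=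
  (x (Multiplicative.ofAdd γ) : Circle)

/-- The Fourier coefficient `∫_G conj (γ(x)) dμ(x)` of a complex measure `μ` on the dual group. -/
noncomputable def fourierCoefficient {Γ : Type*} [AddCommGroup Γ] [TopologicalSpace Γ]
    [MeasurableSpace (DualGroup Γ)] (μ : ComplexMeasure (DualGroup Γ)) (γ : Γ) : ℂ :=
  μ.integral (fun x => (starRingEnd ℂ) (charValue γ x)) (ContinuousLinearMap.mul ℝ ℂ)

/-- The partial sum, over the indices up to and including `j`, of a finitely supported family
of integers. -/
def partialSum {ι : Type*} [LinearOrder ι] (ε : ι →₀ ℤ) (j : ι) : ℤ :=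
  ∑ i ∈ ε.support with i ≤ j, ε i

/-- The four conditions on the integer coefficients `ε`. -/
structure IsSchurCoefficients {ι : Type*} [LinearOrder ι] (ε : ι →₀ ℤ) : Prop where
  /-- The full sum is equal to `1`. -/
  full_sum : (ε.sum fun _ n => n) = 1
  /-- All partial sums are nonnegative. -/
  nonneg : ∀ j, 0 ≤ partialSum ε j
  /-- All partial sums after the first positive one are positive. -/
  pos_of_pos : ∀ i j, i ≤ j → 0 < partialSum ε i → 0 < partialSum ε j
  /-- Some partial sum is greater than `1`. -/
  one_lt : ∃ j, 1 < partialSum ε j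

/-- `Schur((γ_j))`: all `∑ ε_j γ_j` with finitely supported integer coefficients satisfying the
four conditions. Zero coefficients only repeat partial sums, so that for an infinite sequence this
is the union of the corresponding sets over all finite subsequences. -/
def schurSet {ι Γ : Type*} [LinearOrder ι] [AddCommGroup Γ] (γ : ι → Γ) : Set Γ :=
  {m | ∃ ε : ι →₀ ℤ, IsSchurCoefficients ε ∧ m = ε.sum fun j n => n • γ j}

/-- `S((γ_j))`: as `schurSet`, with coefficients restricted to `-1`, `0` and `1`. -/
def smallSchurSet {ι Γ : Type*} [LinearOrder ι] [AddCommGroup Γ] (γ : ι → Γ) : Set Γ :=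
  {m | ∃ ε : ι →₀ ℤ, IsSchurCoefficients ε ∧ (∀ j, ε j = -1 ∨ ε j = 0 ∨ ε j = 1) ∧
    m = ε.sum fun j n => n • γ j}

/-- The indices `0, 1, 2, …` of a sequence of length `J`, finite (`J : ℕ`) or infinite
(`J = ⊤`). -/
abbrev SeqIndex (J : ℕ∞) : Type := {j : ℕ // (j : ℕ∞) < J}

/-! By duality it suffices, for finitely many indices and `∑ |α_j|² ≤ 1`, to find a function bounded
by 1 on `G` of the form `∑ (α_j / 4) γ_j` plus a trigonometric polynomial with frequencies in the
small Schur set. Integrating `μ` against its conjugate, with `α` proportional to `μ̂`, gives the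
bound.

The function is `x ↦ L x X`, where `L x` is a functional on polynomials contractive for the sup norm
on the disc (`exists_contractive_functional`). Each new index composes `L x` with a Fejér-averaged
composition operator `p(z) ↦ p(u φ(ū z))`, `u = ω γ_i(x)`, where `φ` is a quadratic self-map of the
disc. The operator sends `X ^ k` to terms `γ_i ^ (k - m) X ^ m`, so exponents record partial sums
and `k - m` is the coefficient `ε_i`. Averaging leaves only `|k - m| ≤ 1`, which is why the smaller
set suffices. -/

/-- The Fourier coefficients of the Fejér kernel `1 + cos θ`. -/
noncomputable def fejerWeight (n : ℤ) : ℂ :=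
  if n = 0 then 1 else if n = 1 ∨ n = -1 then 1 / 2 else 0

theorem fejerWeight_ne_zero {n : ℤ} (h : fejerWeight n ≠ 0) : n = -1 ∨ n = 0 ∨ n = 1 := by
  unfold fejerWeight at h
  split_ifs at h <;> simp_all
  tauto

theorem integral_exp_int_mul (n : ℤ) :
    ∫ θ in (0 : ℝ)..2 * Real.pi, Complex.exp (n * Complex.I * θ) =
      if n = 0 then 2 * Real.pi else 0 := by
  split_ifs with h
  · simp [h]
  · have hn : (n : ℂ) * Complex.I ≠ 0 := by simp [h]
    rw [integral_exp_mul_complex hn]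
    have : (n : ℂ) * Complex.I * ((2 * Real.pi : ℝ) : ℂ) = n * (2 * Real.pi * Complex.I) := by
      push_cast; ring
    rw [this, Complex.exp_int_mul_two_pi_mul_I]
    simp

theorem integral_fejer_mul_exp (n : ℤ) :
    ∫ θ in (0 : ℝ)..2 * Real.pi,
      ((1 + Real.cos θ : ℝ) : ℂ) * Complex.exp (n * Complex.I * θ) =
      2 * Real.pi * fejerWeight n := by
  have key : ∀ θ : ℝ, ((1 + Real.cos θ : ℝ) : ℂ) * Complex.exp (n * Complex.I * θ) =
      Complex.exp (n * Complex.I * θ) + (1 / 2) * Complex.exp ((n + 1 : ℤ) * Complex.I * θ) +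
        (1 / 2) * Complex.exp ((n - 1 : ℤ) * Complex.I * θ) := by
    intro θ
    have h1 : Complex.exp ((n + 1 : ℤ) * Complex.I * θ) =
        Complex.exp (n * Complex.I * θ) * Complex.exp (θ * Complex.I) := by
      rw [← Complex.exp_add]; push_cast; ring_nf
    have h2 : Complex.exp ((n - 1 : ℤ) * Complex.I * θ) =
        Complex.exp (n * Complex.I * θ) * Complex.exp (-θ * Complex.I) := by
      rw [← Complex.exp_add]; push_cast; ring_nf
    rw [h1, h2]
    push_cast
    rw [Complex.cos]
    ring
  simp_rw [key]
  have hi : ∀ m : ℤ, IntervalIntegrable (fun θ : ℝ => Complex.exp (m * Complex.I * θ))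
      volume 0 (2 * Real.pi) := fun m =>
    Continuous.intervalIntegrable (by fun_prop) _ _
  rw [intervalIntegral.integral_add ((hi _).add ((hi _).const_mul _)) ((hi _).const_mul _),
    intervalIntegral.integral_add (hi _) ((hi _).const_mul _),
    intervalIntegral.integral_const_mul, intervalIntegral.integral_const_mul,
    integral_exp_int_mul, integral_exp_int_mul, integral_exp_int_mul]
  unfold fejerWeight
  rcases eq_or_ne n 0 with rfl | h0
  · simp
  rcases eq_or_ne n 1 with rfl | h1
  · simp
    ring
  rcases eq_or_ne n (-1) with rfl | h2
  · simp
    ring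
  have h3 : n + 1 ≠ 0 := by omega
  have h4 : n - 1 ≠ 0 := by omega
  simp [h0, h1, h2, h3, h4]

open Polynomial in
/-- The Fejér mean over the rotations `ω` of the composition operators
`p ↦ p(ωg · φ(conj(ωg) · z))`, on polynomials. -/
noncomputable def fejerComp (φ : ℂ[X]) (g : ℂ) : ℂ[X] →ₗ[ℂ] ℂ[X] :=
  Polynomial.lsum fun k => LinearMap.toSpanSingleton ℂ ℂ[X]
    ((φ ^ k).sum fun m b =>
      C (fejerWeight (k - m) * (g ^ k * (starRingEnd ℂ g) ^ m) * b) * X ^ m)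

open Polynomial in
theorem fejerComp_monomial (φ : ℂ[X]) (g : ℂ) (k : ℕ) (a : ℂ) :
    fejerComp φ g (monomial k a) = a • ((φ ^ k).sum fun m b =>
      C (fejerWeight (k - m) * (g ^ k * (starRingEnd ℂ g) ^ m) * b) * X ^ m) := by
  unfold fejerComp
  rw [Polynomial.lsum_apply, Polynomial.sum_monomial_index]
  · rfl
  · simp

open Polynomial in
theorem fejerComp_one (φ : ℂ[X]) (g : ℂ) : fejerComp φ g 1 = 1 := by
  rw [← monomial_zero_one, fejerComp_monomial, pow_zero, ← C_1, Polynomial.sum_C_index] <;>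
    simp [fejerWeight]

open Polynomial in
theorem eval_fejerComp (φ : ℂ[X]) (g z : ℂ) (p : ℂ[X]) :
    2 * Real.pi * (fejerComp φ g p).eval z = ∫ θ in (0 : ℝ)..2 * Real.pi,
      ((1 + Real.cos θ : ℝ) : ℂ) * p.eval (Complex.exp (θ * Complex.I) * g *
        φ.eval (starRingEnd ℂ (Complex.exp (θ * Complex.I) * g) * z)) := by
  have hc : ∀ q : ℂ[X], Continuous fun θ : ℝ => ((1 + Real.cos θ : ℝ) : ℂ) *
      q.eval (Complex.exp (θ * Complex.I) * g *
        φ.eval (starRingEnd ℂ (Complex.exp (θ * Complex.I) * g) * z)) := by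
    intro q
    refine Continuous.mul (by fun_prop) (q.continuous.comp (Continuous.mul (by fun_prop)
      (φ.continuous.comp (Continuous.mul ?_ continuous_const))))
    exact Complex.continuous_conj.comp (by fun_prop)
  induction p using Polynomial.induction_on' with
  | add p q hp hq =>
    simp only [map_add, eval_add, mul_add]
    rw [hp, hq, intervalIntegral.integral_add]
    · exact (hc p).intervalIntegrable _ _
    · exact (hc q).intervalIntegrable _ _
  | monomial k a =>
    have hu : ∀ θ : ℝ, starRingEnd ℂ (Complex.exp (θ * Complex.I)) =
        Complex.exp (-(θ * Complex.I)) := by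
      intro θ
      rw [← Complex.exp_conj]
      simp
    have key : ∀ θ : ℝ, ((1 + Real.cos θ : ℝ) : ℂ) *
        (monomial k a).eval (Complex.exp (θ * Complex.I) * g *
          φ.eval (starRingEnd ℂ (Complex.exp (θ * Complex.I) * g) * z)) =
        ∑ m ∈ (φ ^ k).support, (a * (g ^ k * (starRingEnd ℂ g) ^ m) * (φ ^ k).coeff m * z ^ m) *
          (((1 + Real.cos θ : ℝ) : ℂ) *
            Complex.exp (((k : ℤ) - (m : ℤ) : ℤ) * Complex.I * θ)) := by
      intro θ
      rw [eval_monomial, mul_pow, ← eval_pow, eval_eq_sum, Polynomial.sum, Finset.mul_sum,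
        Finset.mul_sum, Finset.mul_sum]
      refine Finset.sum_congr rfl fun m _ => ?_
      have : Complex.exp (((k : ℤ) - (m : ℤ) : ℤ) * Complex.I * θ) =
          Complex.exp (θ * Complex.I) ^ k * Complex.exp (-(θ * Complex.I)) ^ m := by
        rw [← Complex.exp_nat_mul, ← Complex.exp_nat_mul, ← Complex.exp_add]
        push_cast
        ring_nf
      rw [this, map_mul, hu]
      ring
    simp_rw [key]
    rw [intervalIntegral.integral_finsetSum]
    · simp_rw [intervalIntegral.integral_const_mul, integral_fejer_mul_exp]
      rw [fejerComp_monomial, eval_smul, Polynomial.sum, eval_finsetSum, smul_eq_mul,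
        Finset.mul_sum, Finset.mul_sum]
      refine Finset.sum_congr rfl fun m _ => ?_
      simp only [eval_mul, eval_C, eval_pow, eval_X]
      ring
    · intro m _
      exact Continuous.intervalIntegrable (by fun_prop) _ _

-- The kernel `1 + cos θ` is nonnegative with integral `2π`, and each composition evaluates `p` at a
-- point of the closed disc.
open Polynomial in
theorem norm_eval_fejerComp_le {φ : ℂ[X]} (hφ : ∀ z : ℂ, ‖z‖ ≤ 1 → ‖φ.eval z‖ ≤ 1) {g : ℂ}
    (hg : ‖g‖ = 1) {p : ℂ[X]} {M : ℝ} (hp : ∀ z : ℂ, ‖z‖ ≤ 1 → ‖p.eval z‖ ≤ M) {z : ℂ}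
    (hz : ‖z‖ ≤ 1) : ‖(fejerComp φ g p).eval z‖ ≤ M := by
  have hpi : (0 : ℝ) ≤ 2 * Real.pi := by positivity
  have hb : ∀ θ : ℝ, ‖((1 + Real.cos θ : ℝ) : ℂ) * p.eval (Complex.exp (θ * Complex.I) * g *
        φ.eval (starRingEnd ℂ (Complex.exp (θ * Complex.I) * g) * z))‖ ≤
      (1 + Real.cos θ) * M := by
    intro θ
    have h0 : 0 ≤ 1 + Real.cos θ := by linarith [Real.neg_one_le_cos θ]
    rw [norm_mul, Complex.norm_real, Real.norm_of_nonneg h0]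
    refine mul_le_mul_of_nonneg_left (hp _ ?_) h0
    rw [norm_mul, norm_mul, Complex.norm_exp_ofReal_mul_I, hg, one_mul, one_mul]
    refine hφ _ ?_
    rwa [norm_mul, RCLike.norm_conj, norm_mul, Complex.norm_exp_ofReal_mul_I, hg, one_mul,
      one_mul]
  have h := intervalIntegral.norm_integral_le_of_norm_le (μ := volume) hpi
    (Filter.Eventually.of_forall fun θ _ => hb θ)
    (Continuous.intervalIntegrable (by fun_prop) _ _)
  rw [← eval_fejerComp, intervalIntegral.integral_mul_const, intervalIntegral.integral_add
    (by simp) (Continuous.intervalIntegrable (by fun_prop) _ _)] at h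
  simp only [intervalIntegral.integral_const, integral_cos, norm_mul] at h
  simp [abs_of_pos Real.pi_pos] at h
  exact le_of_mul_le_mul_left h Real.two_pi_pos

/-! ### Quadratic self-maps of the disc. -/

open Polynomial in
/-- A quadratic polynomial with value `c` and derivative `P` at `0`. -/
noncomputable def quadPoly (c : ℂ) (P : ℝ) : ℂ[X] :=
  C c + C (P : ℂ) * X - C (starRingEnd ℂ c) * X ^ 2

open Polynomial in
theorem eval_quadPoly (c : ℂ) (P : ℝ) (z : ℂ) :
    (quadPoly c P).eval z = c + P * z - starRingEnd ℂ c * z ^ 2 := by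
  simp [quadPoly]

/-- On the circle, division by `z` leaves the real part `P` and the imaginary part `2 Im(c z̄)`. -/
theorem norm_eval_quadPoly_le_of_norm_eq_one {c : ℂ} {P : ℝ} (h : P ^ 2 + 4 * ‖c‖ ^ 2 ≤ 1) {z : ℂ}
    (hz : ‖z‖ = 1) : ‖(quadPoly c P).eval z‖ ≤ 1 := by
  have hzz : z * starRingEnd ℂ z = 1 := by
    rw [Complex.mul_conj, Complex.normSq_eq_norm_sq, hz]; simp
  have hw : (quadPoly c P).eval z =
      z * (P + (2 * (c * starRingEnd ℂ z).im : ℝ) * Complex.I) := by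
    have := Complex.sub_conj (c * starRingEnd ℂ z)
    rw [← this, eval_quadPoly, map_mul, Complex.conj_conj]
    linear_combination (-c) * hzz
  rw [hw, norm_mul, hz, one_mul, Complex.norm_add_mul_I, Real.sqrt_le_one]
  have hi : (c * starRingEnd ℂ z).im ^ 2 ≤ ‖c‖ ^ 2 := by
    have := Complex.abs_im_le_norm (c * starRingEnd ℂ z)
    rw [norm_mul, RCLike.norm_conj, hz, mul_one] at this
    rw [← sq_abs]
    gcongr
  nlinarith

theorem norm_eval_quadPoly_le {c : ℂ} {P : ℝ} (h : P ^ 2 + 4 * ‖c‖ ^ 2 ≤ 1) {z : ℂ}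
    (hz : ‖z‖ ≤ 1) : ‖(quadPoly c P).eval z‖ ≤ 1 := by
  refine Complex.norm_le_of_forall_mem_frontier_norm_le (U := Metric.ball (0 : ℂ) 1)
    (f := fun z => (quadPoly c P).eval z) Metric.isBounded_ball
    (quadPoly c P).differentiable.diffContOnCl (fun w hw => ?_) ?_
  · rw [frontier_ball _ one_ne_zero] at hw
    exact norm_eval_quadPoly_le_of_norm_eq_one h (by simpa using hw)
  · rw [closure_ball _ one_ne_zero]
    simpa using hz

-- The Fejér weight `1 / 2` halves the two outer coefficients. With `c = α / 2` this produces the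
-- constant 4 of the theorem.
open Polynomial in
theorem fejerComp_quadPoly_X (c : ℂ) (P : ℝ) {g : ℂ} (hg : ‖g‖ = 1) :
    fejerComp (quadPoly c P) g X =
      C (c / 2 * g) + C (P : ℂ) * X - C (starRingEnd ℂ c / 2 * starRingEnd ℂ g) * X ^ 2 := by
  have hgg : g * starRingEnd ℂ g = 1 := by
    rw [Complex.mul_conj, Complex.normSq_eq_norm_sq, hg]; simp
  have h0 : (quadPoly c P).coeff 0 = c := by simp [quadPoly]
  have h1 : (quadPoly c P).coeff 1 = P := by simp [quadPoly, coeff_X_pow, coeff_C]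
  have h2 : (quadPoly c P).coeff 2 = -starRingEnd ℂ c := by
    simp [quadPoly]
  have hd : (quadPoly c P).natDegree < 3 := by
    unfold quadPoly
    refine Nat.lt_succ_of_le (natDegree_le_iff_coeff_eq_zero.2 fun N hN => ?_)
    have a1 : N ≠ 0 := by omega
    have a2 : 1 ≠ N := by omega
    have a3 : N ≠ 2 := by omega
    simp [coeff_X, coeff_C, coeff_X_pow, a1, a2, a3]
  rw [← monomial_one_one_eq_X, fejerComp_monomial, one_smul, pow_one,
    Polynomial.sum_over_range' _ (by simp) 3 hd]
  simp only [Finset.sum_range_succ, Finset.sum_range_zero, h0, h1, h2, monomial_one_one_eq_X]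
  have e0 : fejerWeight (((1 : ℕ) : ℤ) - ((0 : ℕ) : ℤ)) = 1 / 2 := by simp [fejerWeight]
  have e1 : fejerWeight (((1 : ℕ) : ℤ) - ((1 : ℕ) : ℤ)) = 1 := by simp [fejerWeight]
  have e2 : fejerWeight (((1 : ℕ) : ℤ) - ((2 : ℕ) : ℤ)) = 1 / 2 := by simp [fejerWeight]
  rw [e0, e1, e2]
  have i0 : (1 / 2 : ℂ) * (g ^ 1 * starRingEnd ℂ g ^ 0) * c = c / 2 * g := by ring
  have i1 : (1 : ℂ) * (g ^ 1 * starRingEnd ℂ g ^ 1) * P = P := by simp [hgg]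
  have i2 : (1 / 2 : ℂ) * (g ^ 1 * starRingEnd ℂ g ^ 2) * -starRingEnd ℂ c =
      -(starRingEnd ℂ c / 2 * starRingEnd ℂ g) := by
    linear_combination (-1 / 2 * starRingEnd ℂ c * starRingEnd ℂ g) * hgg
  rw [i0, i1, i2]
  simp only [C_neg]
  ring

/-! ### Characters and trigonometric polynomials. -/

section Characters

variable {Γ : Type*} [AddCommGroup Γ] [TopologicalSpace Γ]

theorem charValue_zero (x : DualGroup Γ) : charValue (0 : Γ) x = 1 := by
  simp [charValue]

theorem charValue_add (a b : Γ) (x : DualGroup Γ) :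
    charValue (a + b) x = charValue a x * charValue b x := by
  simp [charValue]

theorem charValue_neg (a : Γ) (x : DualGroup Γ) :
    charValue (-a) x = starRingEnd ℂ (charValue a x) := by
  unfold charValue
  rw [ofAdd_neg, map_inv, Circle.coe_inv_eq_conj]

theorem norm_charValue (a : Γ) (x : DualGroup Γ) : ‖charValue a x‖ = 1 :=
  Circle.norm_coe _

theorem charValue_nsmul (n : ℕ) (a : Γ) (x : DualGroup Γ) :
    charValue (n • a) x = charValue a x ^ n := by
  simp [charValue, ofAdd_nsmul]

theorem charValue_sub_zsmul (k m : ℕ) (a : Γ) (x : DualGroup Γ) :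
    charValue (((k : ℤ) - m) • a) x =
      charValue a x ^ k * starRingEnd ℂ (charValue a x) ^ m := by
  rw [sub_zsmul, natCast_zsmul, natCast_zsmul,
    charValue_add, charValue_neg, charValue_nsmul, charValue_nsmul, map_pow]

theorem continuous_charValue (a : Γ) : Continuous (charValue a) := by
  have h : Continuous fun x : DualGroup Γ => x (Multiplicative.ofAdd a) :=
    (continuous_eval_const (F := C(Multiplicative Γ, Circle)) (Multiplicative.ofAdd a)).comp
      (ContinuousMonoidHom.isInducing_toContinuousMap (Multiplicative Γ) Circle).continuous
  exact continuous_subtype_val.comp h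

/-- The trigonometric polynomials with frequencies in `A`. -/
noncomputable def charSpan (A : Set Γ) : Submodule ℂ (DualGroup Γ → ℂ) :=
  Submodule.span ℂ (charValue '' A)

theorem charValue_mul_mem_charSpan {A B : Set Γ} {a : Γ} (h : ∀ m ∈ A, a + m ∈ B)
    {f : DualGroup Γ → ℂ} (hf : f ∈ charSpan A) :
    (fun x => charValue a x * f x) ∈ charSpan B := by
  induction hf using Submodule.span_induction with
  | mem f hf =>
    obtain ⟨m, hm, rfl⟩ := hf
    refine Submodule.subset_span ⟨a + m, h m hm, ?_⟩
    ext x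
    exact charValue_add _ _ _
  | zero =>
    convert (charSpan B).zero_mem using 1
    ext x
    simp
  | add f g _ _ hf hg =>
    simp only [Pi.add_apply, mul_add]
    exact (charSpan B).add_mem hf hg
  | smul c f _ hf =>
    have : (fun x => charValue a x * (c • f) x) = c • fun x => charValue a x * f x := by
      ext x
      simp only [Pi.smul_apply, smul_eq_mul]
      ring
    rw [this]
    exact (charSpan B).smul_mem c hf

end Characters

/-! ### Combinatorics of the partial sums. -/

section Coefficients

variable {ι : Type*} [LinearOrder ι]

theorem partialSum_eq_sum_ite (ε : ι →₀ ℤ) (j : ι) :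
    partialSum ε j = ε.sum fun i n => if i ≤ j then n else 0 := by
  rw [partialSum, Finset.sum_filter, Finsupp.sum]

theorem partialSum_add_single (ε : ι →₀ ℤ) (i : ι) (δ : ℤ) (j : ι) :
    partialSum (ε + Finsupp.single i δ) j = partialSum ε j + if i ≤ j then δ else 0 := by
  rw [partialSum_eq_sum_ite, partialSum_eq_sum_ite, Finsupp.sum_add_index', Finsupp.sum_single_index]
  · simp
  · simp
  · intro a b c
    split_ifs <;> simp

theorem partialSum_eq_sum {ε : ι →₀ ℤ} {j : ι} (h : ∀ i ∈ ε.support, i ≤ j) :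
    partialSum ε j = ε.sum fun _ n => n := by
  rw [partialSum, Finset.filter_true_of_mem h, Finsupp.sum]

/-- Coefficients in `{-1, 0, 1}` supported in `t` with full sum `k`, satisfying the second and third
of the four conditions. -/
structure IsSmallCoefficients (t : Finset ι) (k : ℤ) (ε : ι →₀ ℤ) : Prop where
  support_subset : ε.support ⊆ t
  small : ∀ j, ε j = -1 ∨ ε j = 0 ∨ ε j = 1
  full_sum : (ε.sum fun _ n => n) = k
  nonneg : ∀ j, 0 ≤ partialSum ε j
  pos_of_pos : ∀ i j, i ≤ j → 0 < partialSum ε i → 0 < partialSum ε j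

theorem isSmallCoefficients_zero (t : Finset ι) : IsSmallCoefficients t 0 0 where
  support_subset := by simp
  small := by simp
  full_sum := by simp
  nonneg := by simp [partialSum]
  pos_of_pos := by simp [partialSum]

/-- As `i` lies beyond `t`, partial sums before `i` are unchanged and those from `i` on equal `k +
δ`. -/
theorem IsSmallCoefficients.add_single {t : Finset ι} {k δ : ℤ} {ε : ι →₀ ℤ}
    (h : IsSmallCoefficients t k ε) {i : ι} (hi : ∀ j ∈ t, j < i) (hδ : δ = -1 ∨ δ = 0 ∨ δ = 1)
    (h0 : 0 ≤ k + δ) (hpos : 0 < k → 0 < k + δ) :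
    IsSmallCoefficients (insert i t) (k + δ) (ε + Finsupp.single i δ) := by
  have hit : i ∉ t := fun hit => (hi i hit).false
  have hsum : ∀ j, i ≤ j → partialSum ε j = k := fun j hj => by
    rw [partialSum_eq_sum, h.full_sum]
    exact fun l hl => ((hi l (h.support_subset hl)).trans_le hj).le
  refine ⟨?_, ?_, ?_, ?_, ?_⟩
  · intro j hj
    rcases Finset.mem_union.1 (Finsupp.support_add hj) with hj | hj
    · exact Finset.mem_insert_of_mem (h.support_subset hj)
    · have := Finsupp.support_single_subset hj
      simp_all
  · intro j
    rcases eq_or_ne i j with rfl | hij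
    · have : ε i = 0 := Finsupp.notMem_support_iff.1 fun hs => hit (h.support_subset hs)
      simpa [this] using hδ
    · simpa [Finsupp.single_apply, hij] using h.small j
  · rw [Finsupp.sum_add_index' (by simp) (by simp), h.full_sum, Finsupp.sum_single_index rfl]
  · intro j
    rw [partialSum_add_single]
    split_ifs with hij
    · rwa [hsum j hij]
    · simpa using h.nonneg j
  · intro a b hab ha
    rw [partialSum_add_single] at ha ⊢
    split_ifs with hib
    · rw [hsum b hib]
      split_ifs at ha with hia
      · rwa [hsum a hia] at ha
      · apply hpos
        rw [← hsum b hib]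
        exact h.pos_of_pos a b hab (by simpa using ha)
    · have hia : ¬ i ≤ a := fun hia => hib (hia.trans hab)
      rw [if_neg hia, add_zero] at ha
      simpa using h.pos_of_pos a b hab ha

theorem IsSmallCoefficients.isSchurCoefficients {t : Finset ι} {ε : ι →₀ ℤ}
    (h : IsSmallCoefficients t 2 ε) {i : ι} (hi : ∀ j ∈ t, j < i) :
    IsSchurCoefficients (ε + Finsupp.single i (-1)) := by
  have h' := h.add_single hi (.inl rfl) (by norm_num) (by norm_num)
  refine ⟨by simpa using h'.full_sum, h'.nonneg, h'.pos_of_pos, ?_⟩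
  have hne : ε.support.Nonempty := by
    rw [Finset.nonempty_iff_ne_empty]
    intro he
    have := h.full_sum
    rw [Finsupp.sum, he, Finset.sum_empty] at this
    omega
  -- At the last index used by `ε` the partial sum is 2, and the final `-1` comes strictly later.
  refine ⟨ε.support.max' hne, ?_⟩
  have hlt := hi _ (h.support_subset (ε.support.max'_mem hne))
  rw [partialSum_add_single, if_neg hlt.not_ge, partialSum_eq_sum fun j hj =>
    ε.support.le_max' j hj, h.full_sum]
  norm_num

variable {Γ : Type*} [AddCommGroup Γ]

/-- The sums `∑ ε_j γ_j` with coefficients as in `IsSmallCoefficients`. -/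
def smallSums (γ : ι → Γ) (t : Finset ι) (k : ℤ) : Set Γ :=
  {m | ∃ ε : ι →₀ ℤ, IsSmallCoefficients t k ε ∧ m = ε.sum fun j n => n • γ j}

theorem sum_add_single_zsmul {ι Γ : Type*} [AddCommGroup Γ] (γ : ι → Γ) (ε : ι →₀ ℤ) (i : ι) (δ : ℤ) :
    ((ε + Finsupp.single i δ).sum fun j n => n • γ j) =
      δ • γ i + ε.sum fun j n => n • γ j := by
  rw [Finsupp.sum_add_index' (by simp) (fun _ _ _ => add_smul _ _ _),
    Finsupp.sum_single_index (by simp), add_comm]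

theorem zero_mem_smallSums (γ : ι → Γ) (t : Finset ι) : (0 : Γ) ∈ smallSums γ t 0 :=
  ⟨0, isSmallCoefficients_zero t, by simp⟩

theorem zsmul_add_mem_smallSums {γ : ι → Γ} {t : Finset ι} {i : ι} (hi : ∀ j ∈ t, j < i)
    {k δ : ℤ} (hδ : δ = -1 ∨ δ = 0 ∨ δ = 1) (h0 : 0 ≤ k + δ) (hpos : 0 < k → 0 < k + δ)
    {m : Γ} (hm : m ∈ smallSums γ t k) : δ • γ i + m ∈ smallSums γ (insert i t) (k + δ) := by
  obtain ⟨ε, hε, rfl⟩ := hm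
  exact ⟨_, hε.add_single hi hδ h0 hpos, (sum_add_single_zsmul γ ε i δ).symm⟩

theorem neg_add_mem_smallSchurSet {γ : ι → Γ} {t : Finset ι} {i : ι} (hi : ∀ j ∈ t, j < i)
    {m : Γ} (hm : m ∈ smallSums γ t 2) : -γ i + m ∈ smallSchurSet γ := by
  obtain ⟨ε, hε, rfl⟩ := hm
  refine ⟨_, hε.isSchurCoefficients hi,
    (hε.add_single hi (.inl rfl) (by norm_num) (by norm_num)).small, ?_⟩
  rw [sum_add_single_zsmul, neg_one_zsmul]

end Coefficients

/-! ### Inductive construction of the contractive functionals. -/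

open Polynomial in
theorem exists_contractive_functional {ι Γ : Type*} [LinearOrder ι] [AddCommGroup Γ]
    [TopologicalSpace Γ] (γ : ι → Γ) (t : Finset ι) :
    ∀ α : ι → ℂ, ∑ i ∈ t, ‖α i‖ ^ 2 ≤ 1 → ∃ L : DualGroup Γ → (ℂ[X] →ₗ[ℂ] ℂ),
      (∀ x p M, (∀ z : ℂ, ‖z‖ ≤ 1 → ‖p.eval z‖ ≤ M) → ‖L x p‖ ≤ M) ∧
      (∀ x, L x 1 = 1) ∧
      (∀ k : ℕ, (fun x => L x (X ^ k)) ∈ charSpan (smallSums γ t k)) ∧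
      (fun x => L x X - ∑ i ∈ t, α i / 4 * charValue (γ i) x) ∈ charSpan (smallSchurSet γ) := by
  induction t using Finset.induction_on_max with
  | empty =>
    intro α _
    -- Evaluation at 0 kills every `X ^ k` with `k > 0`: the empty sum has only the level 0.
    refine ⟨fun _ => leval 0, fun x p M h => h 0 (by simp), fun x => by simp, fun k => ?_, ?_⟩
    · rcases Nat.eq_zero_or_pos k with rfl | hk
      · refine Submodule.subset_span ⟨0, by simpa using zero_mem_smallSums γ ∅, ?_⟩
        ext x
        simp [charValue_zero]
      · convert (charSpan (smallSums γ ∅ k)).zero_mem using 1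
        ext x
        simp [hk.ne']
    · convert (charSpan (smallSchurSet γ)).zero_mem using 1
      ext x
      simp
  | insert i t hi ih =>
    intro α hα
    have hit : i ∉ t := fun hit => (hi i hit).false
    rw [Finset.sum_insert hit] at hα
    have ht0 : 0 ≤ ∑ j ∈ t, ‖α j‖ ^ 2 := Finset.sum_nonneg fun _ _ => sq_nonneg _
    set P : ℝ := √(1 - ‖α i‖ ^ 2) with hP
    have hPsq : P ^ 2 = 1 - ‖α i‖ ^ 2 := Real.sq_sqrt (by linarith)
    -- If `P = 0`, then `|α i| = 1` forces the other `α j` to vanish, so division by zero does no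
    -- harm.
    have hPα : ∀ j ∈ t, (P : ℂ) * (α j / P) = α j := by
      intro j hj
      rcases eq_or_ne P 0 with h0 | h0
      · have h1 : ‖α j‖ ^ 2 ≤ ∑ j ∈ t, ‖α j‖ ^ 2 :=
          Finset.single_le_sum (f := fun j => ‖α j‖ ^ 2) (fun _ _ => sq_nonneg _) hj
        rw [h0] at hPsq
        have h2 : ‖α j‖ ^ 2 ≤ 0 := by linarith
        have h3 : α j = 0 := by
          have : ‖α j‖ ^ 2 = 0 := le_antisymm h2 (sq_nonneg _)
          simpa using this
        simp [h3]
      · have : (P : ℂ) ≠ 0 := by exact_mod_cast h0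
        field_simp
    have hα' : ∑ j ∈ t, ‖α j / P‖ ^ 2 ≤ 1 := by
      simp only [norm_div, div_pow, Complex.norm_real, Real.norm_eq_abs, sq_abs]
      rw [← Finset.sum_div, hPsq]
      exact div_le_one_of_le₀ (by linarith) (by linarith)
    obtain ⟨L, hL, hL1, hLk, hLX⟩ := ih (fun j => α j / P) hα'
    have hφ : ∀ z : ℂ, ‖z‖ ≤ 1 → ‖(quadPoly (α i / 2) P).eval z‖ ≤ 1 := fun z hz => by
      refine norm_eval_quadPoly_le ?_ hz
      rw [hPsq, norm_div]
      norm_num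
      ring_nf
      rfl
    refine ⟨fun x => L x ∘ₗ fejerComp (quadPoly (α i / 2) P) (charValue (γ i) x), ?_, ?_, ?_, ?_⟩
    · intro x p M hp
      exact hL x _ M fun z hz => norm_eval_fejerComp_le hφ (norm_charValue _ _) hp hz
    · intro x
      simp [fejerComp_one, hL1]
    · intro k
      have key : (fun x => (L x ∘ₗ fejerComp (quadPoly (α i / 2) P) (charValue (γ i) x)) (X ^ k)) =
          ∑ m ∈ (quadPoly (α i / 2) P ^ k).support,
            (fejerWeight (k - m) * (quadPoly (α i / 2) P ^ k).coeff m) •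
              fun x => charValue (((k : ℤ) - m) • γ i) x * L x (X ^ m) := by
        ext x
        rw [LinearMap.comp_apply, ← monomial_one_right_eq_X_pow, fejerComp_monomial, one_smul,
          Polynomial.sum, map_sum, Finset.sum_apply]
        refine Finset.sum_congr rfl fun m _ => ?_
        rw [← smul_eq_C_mul, map_smul]
        simp only [Pi.smul_apply, smul_eq_mul]
        rw [charValue_sub_zsmul]
        ring
      rw [key]
      refine Submodule.sum_mem _ fun m hm => ?_
      rcases eq_or_ne (fejerWeight (k - m)) 0 with hw | hw
      · simp [hw]
      refine Submodule.smul_mem _ _ (charValue_mul_mem_charSpan (fun a ha => ?_) (hLk m))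
      -- Since `φ ^ 0 = 1`, level 0 is reached only from level 0: partial sums stay positive once
      -- they are positive.
      have hpos : 0 < m → 0 < k := by
        intro hm0
        by_contra hk
        obtain rfl : k = 0 := by omega
        rw [pow_zero, mem_support_iff, coeff_one, if_neg hm0.ne'] at hm
        exact hm rfl
      have := zsmul_add_mem_smallSums hi (fejerWeight_ne_zero hw) (by omega) (by omega) ha
      rwa [add_sub_cancel] at this
    -- The constant term of the averaged map gives `α i / 4`, the linear term rescales the previous
    -- step by `P`, and the quadratic term descends from level 2 to level 1, hence lies in the small
    -- Schur set.
    · have key : (fun x => (L x ∘ₗ fejerComp (quadPoly (α i / 2) P) (charValue (γ i) x)) X -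
          ∑ j ∈ insert i t, α j / 4 * charValue (γ j) x) =
          (P : ℂ) • (fun x => L x X - ∑ j ∈ t, α j / P / 4 * charValue (γ j) x) -
            (starRingEnd ℂ (α i / 2) / 2) • fun x => charValue (-γ i) x * L x (X ^ 2) := by
        ext x
        have hs : ∑ j ∈ t, α j / 4 * charValue (γ j) x =
            P * ∑ j ∈ t, α j / P / 4 * charValue (γ j) x := by
          rw [Finset.mul_sum]
          refine Finset.sum_congr rfl fun j hj => ?_
          nth_rw 1 [← hPα j hj]
          ring
        rw [LinearMap.comp_apply, fejerComp_quadPoly_X _ _ (norm_charValue _ _),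
          Finset.sum_insert hit, hs, map_sub, map_add, ← smul_eq_C_mul,
          ← smul_eq_C_mul, map_smul, map_smul, ← mul_one (C _), ← smul_eq_C_mul, map_smul, hL1]
        simp only [Pi.sub_apply, Pi.smul_apply, smul_eq_mul]
        rw [charValue_neg]
        ring
      rw [key]
      refine Submodule.sub_mem _ (Submodule.smul_mem _ _ hLX) (Submodule.smul_mem _ _
        (charValue_mul_mem_charSpan (fun m hm => neg_add_mem_smallSchurSet hi hm) ?_))
      exact_mod_cast hLk 2

/-! ### Integration against the measure and duality. -/

theorem integral_const_mul_complexMeasure {X : Type*} [MeasurableSpace X] (μ : ComplexMeasure X)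
    (c : ℂ) (f : X → ℂ) :
    μ.integral (fun x => c * f x) (ContinuousLinearMap.mul ℝ ℂ) =
      c * μ.integral f (ContinuousLinearMap.mul ℝ ℂ) := by
  refine setToFun_smul (𝕜 := ℂ) _ (fun c s x => ?_) c f
  change c • x * μ s = c • (x * μ s)
  exact smul_mul_assoc _ _ _

theorem norm_integral_complexMeasure_le {X : Type*} [MeasurableSpace X]
    (μ : ComplexMeasure X) [IsFiniteMeasure μ.variation] {f : X → ℂ} (hf : ∀ x, ‖f x‖ ≤ 1) :
    ‖μ.integral f (ContinuousLinearMap.mul ℝ ℂ)‖ ≤ μ.variation.real Set.univ := by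
  refine VectorMeasure.norm_integral_le_integral_norm.trans ?_
  rw [ContinuousLinearMap.opNorm_mul, one_mul]
  refine (integral_mono_of_nonneg (.of_forall fun x => norm_nonneg _) (integrable_const (1 : ℝ))
    (.of_forall hf)).trans ?_
  simp

section Coefficients

variable {Γ : Type*} [AddCommGroup Γ] [TopologicalSpace Γ] [DiscreteTopology Γ]
  [MeasurableSpace (DualGroup Γ)] [BorelSpace (DualGroup Γ)]

theorem integrable_complexMeasure_of_continuous (μ : ComplexMeasure (DualGroup Γ))
    [IsFiniteMeasure μ.variation] {f : DualGroup Γ → ℂ} (hf : Continuous f) :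
    μ.Integrable f :=
  hf.integrable_of_hasCompactSupport (.of_compactSpace f)

theorem integral_conj_eq_zero_of_mem_charSpan (μ : ComplexMeasure (DualGroup Γ))
    [IsFiniteMeasure μ.variation] {A : Set Γ} (hA : ∀ m ∈ A, fourierCoefficient μ m = 0)
    {h : DualGroup Γ → ℂ} (hh : h ∈ charSpan A) :
    Continuous h ∧
      μ.integral (fun x => starRingEnd ℂ (h x)) (ContinuousLinearMap.mul ℝ ℂ) = 0 := by
  induction hh using Submodule.span_induction with
  | mem f hf =>
    obtain ⟨m, hm, rfl⟩ := hf
    exact ⟨continuous_charValue m, hA m hm⟩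
  | zero => exact ⟨continuous_const, by simp⟩
  | add f g _ _ hf hg =>
    refine ⟨hf.1.add hg.1, ?_⟩
    simp only [Pi.add_apply, map_add]
    rw [VectorMeasure.integral_fun_add
      (integrable_complexMeasure_of_continuous μ (Complex.continuous_conj.comp' hf.1))
      (integrable_complexMeasure_of_continuous μ (Complex.continuous_conj.comp' hg.1)), hf.2, hg.2, add_zero]
  | smul c f _ hf =>
    refine ⟨hf.1.const_smul c, ?_⟩
    simp only [Pi.smul_apply, smul_eq_mul, map_mul]
    rw [integral_const_mul_complexMeasure, hf.2, mul_zero]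

theorem sqrt_sum_fourierCoefficient_le {ι : Type*} [LinearOrder ι]
    (μ : ComplexMeasure (DualGroup Γ)) [IsFiniteMeasure μ.variation] (γ : ι → Γ)
    (hγ : ∀ m ∈ smallSchurSet γ, fourierCoefficient μ m = 0) (t : Finset ι) :
    √(∑ i ∈ t, ‖fourierCoefficient μ (γ i)‖ ^ 2) ≤ 4 * μ.variation.real Set.univ := by
  have hs0 : 0 ≤ ∑ i ∈ t, ‖fourierCoefficient μ (γ i)‖ ^ 2 :=
    Finset.sum_nonneg fun _ _ => sq_nonneg _
  set N : ℝ := √(∑ i ∈ t, ‖fourierCoefficient μ (γ i)‖ ^ 2) with hN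
  have hNsq : N ^ 2 = ∑ i ∈ t, ‖fourierCoefficient μ (γ i)‖ ^ 2 := Real.sq_sqrt hs0
  rcases (show 0 ≤ N from Real.sqrt_nonneg _).eq_or_lt with h0 | h0
  · rw [← h0]
    positivity
  -- The normalised coefficients `μ̂(γ_i) / N` are the equality case of Cauchy–Schwarz; the integral
  -- becomes `N / 4`.
  obtain ⟨L, hL, -, -, hX⟩ := exists_contractive_functional γ t
    (fun i => fourierCoefficient μ (γ i) / N) (by
      simp only [norm_div, div_pow, Complex.norm_real, Real.norm_eq_abs, sq_abs]
      rw [← Finset.sum_div, ← hNsq]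
      exact div_self_le_one _)
  obtain ⟨hcont, hzero⟩ := integral_conj_eq_zero_of_mem_charSpan μ hγ hX
  have hbound := norm_integral_complexMeasure_le μ
    (f := fun x => starRingEnd ℂ (L x Polynomial.X)) fun x => by
      rw [RCLike.norm_conj]
      exact hL x _ 1 fun z hz => by simpa using hz
  have hterm : ∀ i, Continuous fun x => starRingEnd ℂ (fourierCoefficient μ (γ i) / N / 4) *
      starRingEnd ℂ (charValue (γ i) x) := fun i =>
    continuous_const.mul (Complex.continuous_conj.comp (continuous_charValue _))
  have hval : μ.integral (fun x => starRingEnd ℂ (L x Polynomial.X))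
      (ContinuousLinearMap.mul ℝ ℂ) = ((N / 4 : ℝ) : ℂ) := by
    have hsplit : (fun x => starRingEnd ℂ (L x Polynomial.X)) = fun x =>
        starRingEnd ℂ (L x Polynomial.X -
          ∑ i ∈ t, fourierCoefficient μ (γ i) / N / 4 * charValue (γ i) x) +
        ∑ i ∈ t, starRingEnd ℂ (fourierCoefficient μ (γ i) / N / 4) *
          starRingEnd ℂ (charValue (γ i) x) := by
      ext x
      simp only [map_sub, map_sum, map_mul]
      ring
    rw [hsplit, VectorMeasure.integral_fun_add
      (integrable_complexMeasure_of_continuous μ (Complex.continuous_conj.comp' hcont))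
      (integrable_complexMeasure_of_continuous μ (continuous_finsetSum _ fun i _ => hterm i)), hzero, zero_add,
      VectorMeasure.integral_finsetSum _ fun i _ => integrable_complexMeasure_of_continuous μ (hterm i)]
    have : ∀ i, μ.integral (fun x => starRingEnd ℂ (fourierCoefficient μ (γ i) / N / 4) *
        starRingEnd ℂ (charValue (γ i) x)) (ContinuousLinearMap.mul ℝ ℂ) =
        ((‖fourierCoefficient μ (γ i)‖ ^ 2 / (4 * N) : ℝ) : ℂ) := by
      intro i
      rw [integral_const_mul_complexMeasure]
      change _ * fourierCoefficient μ (γ i) = _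
      push_cast
      rw [← Complex.conj_mul', map_div₀, map_div₀, Complex.conj_ofReal, Complex.conj_ofNat]
      ring
    simp_rw [this]
    rw [← Complex.ofReal_sum, ← Finset.sum_div, ← hNsq]
    congr 1
    field_simp
  rw [hval, Complex.norm_real, Real.norm_of_nonneg (by positivity)] at hbound
  linarith

end Coefficients

/-! ### Passage to all of `K`. -/

theorem smallSchurSet_subset_schurSet {ι Γ : Type*} [LinearOrder ι] [AddCommGroup Γ] (γ : ι → Γ) :
    smallSchurSet γ ⊆ schurSet γ := fun _ ⟨ε, hε, _, hm⟩ => ⟨ε, hε, hm⟩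

theorem tsum_fourierCoefficient_rpow_le {Γ : Type*} [AddCommGroup Γ] [TopologicalSpace Γ]
    [DiscreteTopology Γ] [MeasurableSpace (DualGroup Γ)] [BorelSpace (DualGroup Γ)]
    {ι : Type*} [LinearOrder ι] (μ : ComplexMeasure (DualGroup Γ)) [IsFiniteMeasure μ.variation]
    (γ : ι → Γ) (hγ : ∀ m ∈ smallSchurSet γ, fourierCoefficient μ m = 0) :
    (∑' κ : Set.range γ, ‖fourierCoefficient μ κ‖ₑ ^ 2) ^ (1 / 2 : ℝ) ≤
      4 * μ.variation Set.univ := by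
  -- One index is chosen for each value, so repetitions in the sequence are not counted twice.
  choose i hi using fun κ : Set.range γ => κ.2
  have hinj : Function.Injective i := fun a b hab => Subtype.ext (by rw [← hi a, ← hi b, hab])
  have hfin : ∀ s : Finset (Set.range γ),
      ∑ κ ∈ s, ‖fourierCoefficient μ κ‖ₑ ^ 2 ≤ (4 * μ.variation Set.univ) ^ 2 := by
    intro s
    have h := sqrt_sum_fourierCoefficient_le μ γ hγ (s.map ⟨i, hinj⟩)
    rw [Finset.sum_map] at h
    simp only [Function.Embedding.coeFn_mk, hi] at h
    rw [Real.sqrt_le_left (by positivity)] at h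
    have h' := ENNReal.ofReal_le_ofReal h
    rw [ENNReal.ofReal_sum_of_nonneg fun _ _ => sq_nonneg _, ENNReal.ofReal_pow (by positivity),
      ENNReal.ofReal_mul (by norm_num), ofReal_measureReal] at h'
    simpa only [ENNReal.ofReal_pow (norm_nonneg _), ofReal_norm, ENNReal.ofReal_ofNat] using h'
  have htsum : ∑' κ : Set.range γ, ‖fourierCoefficient μ κ‖ₑ ^ 2 ≤
      (4 * μ.variation Set.univ) ^ 2 := by
    rw [ENNReal.tsum_eq_iSup_sum]
    exact iSup_le hfin
  calc _ ≤ ((4 * μ.variation Set.univ) ^ 2) ^ (1 / 2 : ℝ) := by gcongr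
    _ = _ := by
      rw [← ENNReal.rpow_natCast, ← ENNReal.rpow_mul]
      norm_num

theorem theorem5 {Γ : Type*} [AddCommGroup Γ] [TopologicalSpace Γ] [DiscreteTopology Γ]
    [MeasurableSpace (DualGroup Γ)] [BorelSpace (DualGroup Γ)]
    (K : Set Γ) (μ : ComplexMeasure (DualGroup Γ)) (hμ : μ.variation.Regular)
    (J : ℕ∞) (γ : SeqIndex J → Γ) (hγ : Set.range γ = K) :
    ((∀ m ∈ schurSet γ, fourierCoefficient μ m = 0) →
      (∑' κ : K, ‖fourierCoefficient μ κ‖ₑ ^ 2) ^ (1 / 2 : ℝ) ≤ 4 * μ.variation Set.univ) ∧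
    ((∀ m ∈ smallSchurSet γ, fourierCoefficient μ m = 0) →
      (∑' κ : K, ‖fourierCoefficient μ κ‖ₑ ^ 2) ^ (1 / 2 : ℝ) ≤ 4 * μ.variation Set.univ) := by
  subst hγ
  -- Regularity makes the variation finite on compact sets, and the dual of a discrete group is
  -- compact.
  have : IsFiniteMeasure μ.variation := CompactSpace.isFiniteMeasure
  exact ⟨fun h => tsum_fourierCoefficient_rpow_le μ γ fun m hm =>
    h m (smallSchurSet_subset_schurSet γ hm), tsum_fourierCoefficient_rpow_le μ γ⟩
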